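/- For $a=(a_1,\dots,a_4),\ b=(b_1,\dots,b_4)\in\mathbb R^4$ and $c=(c_1,\dots,c_4)\in\mathbb C^4$, let $X(a,b,c)$ be the $8\times 8$ self-adjoint matrix whose diagonal is $(a_1,a_2,a_3,a_4,b_4,b_3,b_2,b_1)$, whose anti-diagonal, read from the top right to the bottom left corner, is $(c_1,c_2,c_3,c_4,\bar c_4,\bar c_3,\bar c_2,\bar c_1)$, and whose other entries are zero. It acts on $\mathbb C^2\otimes\mathbb C^2\otimes\mathbb C^2$ with the product basis in lexicographic order. A three-qubit X-state is a positive semidefinite matrix $\varrho=X(a,b,c)$, not necessarily of trace one. It is called separable if it is a nonnegative multiple of a convex combination of pure product states, that is, of matrices $|\psi\rangle\langle\psi|$ with $\psi=x\otimes y\otimes w$ for unit vectors $x,y,w\in\mathbb C^2$ (if $\operatorname{tr}\varrho=1$, the multiple is necessarily $1$). Put $$\Delta_\varrho=\min\Bigl\{\sqrt{a_1b_1},\ \sqrt{a_2b_2},\ \sqrt{a_3b_3},\ \sqrt{a_4b_4},\ \sqrt[4]{a_1b_2b_3a_4},\ \sqrt[4]{b_1a_2a_3b_4}\Bigr\},$$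 and, for $z,c\in\mathbb C^4$, $$\|z\|_{\mathsf X}=\max_{\sigma\in\mathbb R}\bigl(|z_1e^{\mathrm i\sigma}+\bar z_4|+|z_2e^{\mathrm i\sigma}+\bar z_3|\bigr),\qquad \|c\|'_{\mathsf X}=\max\Bigl\{\operatorname{Re}\sum_{i=1}^4c_iz_i:\ z\in\mathbb C^4,\ \|z\|_{\mathsf X}=1\Bigr\},$$ so that $\|\cdot\|'_{\mathsf X}$ is the dual norm of the norm $\|\cdot\|_{\mathsf X}$. **Theorem.** A three-qubit X-state $\varrho=X(a,b,c)$ is separable if and only if $\Delta_\varrho\ge\|c\|'_{\mathsf X}$. -/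

import Mathlib

namespace XState

open scoped ComplexOrder

noncomputable section

/-- The self-adjoint `X`-shaped `8 × 8` matrix `X(a, b, c)` (lexicographic order of the indices
`000, 001, …, 111`); here `a 0, …, a 3` stand for `a₁, …, a₄`, and likewise for `b`, `c`. -/
def xMatrix (a b : Fin 4 → ℝ) (c : Fin 4 → ℂ) : Matrix (Fin 8) (Fin 8) ℂ :=
  !![(a 0 : ℂ), 0, 0, 0, 0, 0, 0, c 0;
     0, (a 1 : ℂ), 0, 0, 0, 0, c 1, 0;
     0, 0, (a 2 : ℂ), 0, 0, c 2, 0, 0;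
     0, 0, 0, (a 3 : ℂ), c 3, 0, 0, 0;
     0, 0, 0, star (c 3), (b 3 : ℂ), 0, 0, 0;
     0, 0, star (c 2), 0, 0, (b 2 : ℂ), 0, 0;
     0, star (c 1), 0, 0, 0, 0, (b 1 : ℂ), 0;
     star (c 0), 0, 0, 0, 0, 0, 0, (b 0 : ℂ)]

/-- A (possibly unnormalized) three-qubit state: a positive semidefinite `8 × 8` matrix. -/
def IsState (ρ : Matrix (Fin 8) (Fin 8) ℂ) : Prop :=
  ρ.PosSemidef

/-- The product vector `x ⊗ y ⊗ z` of `ℂ² ⊗ ℂ² ⊗ ℂ² = ℂ⁸`, in lexicographic order. -/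
def prodVec (x y z : EuclideanSpace ℂ (Fin 2)) : Fin 8 → ℂ :=
  ![x 0 * y 0 * z 0, x 0 * y 0 * z 1, x 0 * y 1 * z 0, x 0 * y 1 * z 1,
    x 1 * y 0 * z 0, x 1 * y 0 * z 1, x 1 * y 1 * z 0, x 1 * y 1 * z 1]

/-- The three-qubit pure product states: the rank one projections onto the lines spanned by the
unit product vectors. -/
def pureProductStates : Set (Matrix (Fin 8) (Fin 8) ℂ) :=
  {P | ∃ x y z : EuclideanSpace ℂ (Fin 2), ‖x‖ = 1 ∧ ‖y‖ = 1 ∧ ‖z‖ = 1 ∧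
    P = Matrix.vecMulVec (prodVec x y z) (star (prodVec x y z))}

/-- Separability of a (possibly unnormalized) three-qubit state: it is a nonnegative multiple of a
convex combination of pure product states. For matrices of trace one the multiple is necessarily
one, see `isSeparable_iff_of_trace_eq_one`. -/
def IsSeparable (ρ : Matrix (Fin 8) (Fin 8) ℂ) : Prop :=
  ∃ t : ℝ, 0 ≤ t ∧ ∃ σ ∈ convexHull ℝ pureProductStates, ρ = t • σ

/-- The quantity `Δ_ρ` of `ρ = X(a, b, c)`; it depends on the diagonal entries only. -/
def delta (a b : Fin 4 → ℝ) : ℝ :=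
  min (min (min √(a 0 * b 0) √(a 1 * b 1)) (min √(a 2 * b 2) √(a 3 * b 3)))
    (min ((a 0 * b 1 * b 2 * a 3) ^ (1 / 4 : ℝ)) ((b 0 * a 1 * a 2 * b 3) ^ (1 / 4 : ℝ)))

/-- The norm `‖z‖_X = max_σ (|z₁ e^{iσ} + z̄₄| + |z₂ e^{iσ} + z̄₃|)` on `ℂ⁴`. -/
def xNorm (z : Fin 4 → ℂ) : ℝ :=
  ⨆ σ : ℝ, (‖z 0 * Complex.exp (σ * Complex.I) + star (z 3)‖ +
    ‖z 1 * Complex.exp (σ * Complex.I) + star (z 2)‖)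

/-- The dual norm `‖c‖'_X = max {Re ⟨c, z⟩ : ‖z‖_X = 1}` for the bilinear form
`⟨c, z⟩ = ∑ cᵢ zᵢ`. -/
def xDualNorm (c : Fin 4 → ℂ) : ℝ :=
  sSup {r : ℝ | ∃ z : Fin 4 → ℂ, xNorm z = 1 ∧ r = (∑ i, c i * z i).re}

/-! The suprema above are taken over nonempty sets that are bounded above. -/

theorem xNorm_bddAbove (z : Fin 4 → ℂ) :
    BddAbove (Set.range fun σ : ℝ => ‖z 0 * Complex.exp (σ * Complex.I) + star (z 3)‖ +
      ‖z 1 * Complex.exp (σ * Complex.I) + star (z 2)‖) := by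
  refine ⟨‖z 0‖ + ‖z 3‖ + (‖z 1‖ + ‖z 2‖), ?_⟩
  rintro _ ⟨σ, rfl⟩
  have h1 := norm_add_le (z 0 * Complex.exp (σ * Complex.I)) (star (z 3))
  have h2 := norm_add_le (z 1 * Complex.exp (σ * Complex.I)) (star (z 2))
  simp only [norm_mul, Complex.norm_exp_ofReal_mul_I, norm_star, mul_one] at h1 h2
  exact add_le_add h1 h2

theorem norm_le_xNorm (z : Fin 4 → ℂ) (i : Fin 4) : ‖z i‖ ≤ xNorm z := by
  have h0 := le_ciSup (xNorm_bddAbove z) 0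
  have hp := le_ciSup (xNorm_bddAbove z) Real.pi
  change _ ≤ xNorm z at h0 hp
  simp only [Complex.ofReal_zero, zero_mul, Complex.exp_zero, mul_one, Complex.exp_pi_mul_I,
    mul_neg] at h0 hp
  have key : ∀ u v : ℂ, 2 * ‖u‖ ≤ ‖u + v‖ + ‖-u + v‖ ∧ 2 * ‖v‖ ≤ ‖u + v‖ + ‖-u + v‖ := by
    intro u v
    have e1 : (2 : ℂ) * u = (u + v) - (-u + v) := by ring
    have e2 : (2 : ℂ) * v = (u + v) + (-u + v) := by ring
    have n1 := norm_sub_le (u + v) (-u + v)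
    have n2 := norm_add_le (u + v) (-u + v)
    rw [← e1] at n1
    rw [← e2] at n2
    simp only [norm_mul, Complex.norm_ofNat] at n1 n2
    exact ⟨n1, n2⟩
  have k1 := key (z 0) (star (z 3))
  have k2 := key (z 1) (star (z 2))
  simp only [norm_star] at k1 k2
  have := norm_nonneg (z 0)
  have := norm_nonneg (z 1)
  fin_cases i <;> simp only [Fin.zero_eta, Fin.mk_one, Fin.reduceFinMk] <;> linarith

theorem xDualNorm_bddAbove (c : Fin 4 → ℂ) :
    BddAbove {r : ℝ | ∃ z : Fin 4 → ℂ, xNorm z = 1 ∧ r = (∑ i, c i * z i).re} := by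
  refine ⟨∑ i, ‖c i‖, ?_⟩
  rintro _ ⟨z, hz, rfl⟩
  refine (Complex.re_le_norm _).trans ((norm_sum_le _ _).trans (Finset.sum_le_sum fun i _ => ?_))
  rw [norm_mul]
  have := norm_le_xNorm z i
  rw [hz] at this
  exact mul_le_of_le_one_right (norm_nonneg _) this

theorem xDualNorm_nonempty (c : Fin 4 → ℂ) :
    {r : ℝ | ∃ z : Fin 4 → ℂ, xNorm z = 1 ∧ r = (∑ i, c i * z i).re}.Nonempty := by
  refine ⟨_, ![1, 0, 0, 0], ?_, rfl⟩
  simp [xNorm]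

theorem trace_of_mem_convexHull {σ : Matrix (Fin 8) (Fin 8) ℂ}
    (hσ : σ ∈ convexHull ℝ pureProductStates) : σ.trace = 1 := by
  have hc : Convex ℝ {σ : Matrix (Fin 8) (Fin 8) ℂ | σ.trace = 1} := by
    intro A hA B hB s t _ _ hst
    change A.trace = 1 at hA
    change B.trace = 1 at hB
    change (s • A + t • B).trace = 1
    rw [Matrix.trace_add, Matrix.trace_smul, Matrix.trace_smul, hA, hB, ← add_smul, hst, one_smul]
  refine convexHull_min ?_ hc hσ
  rintro _ ⟨x, y, z, hx, hy, hz, rfl⟩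
  have key : ∀ v : EuclideanSpace ℂ (Fin 2), ‖v‖ = 1 →
      v 0 * star (v 0) + v 1 * star (v 1) = 1 := by
    intro v hv
    have h := EuclideanSpace.norm_sq_eq v
    rw [hv, Fin.sum_univ_two] at h
    simp only [Complex.star_def, Complex.mul_conj']
    exact_mod_cast (by linarith : ‖v 0‖ ^ 2 + ‖v 1‖ ^ 2 = 1)
  have e : (Matrix.vecMulVec (prodVec x y z) (star (prodVec x y z))).trace =
      (x 0 * star (x 0) + x 1 * star (x 1)) * (y 0 * star (y 0) + y 1 * star (y 1)) *
        (z 0 * star (z 0) + z 1 * star (z 1)) := by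
    simp only [Matrix.trace, Matrix.diag_apply, Matrix.vecMulVec_apply, Pi.star_apply,
      Fin.sum_univ_eight]
    simp [prodVec]
    ring
  change (Matrix.vecMulVec (prodVec x y z) (star (prodVec x y z))).trace = 1
  simp only [e, key x hx, key y hy, key z hz, mul_one]

/-- For a normalized state, separability is membership in the convex hull of the pure product
states. -/
theorem isSeparable_iff_of_trace_eq_one {ρ : Matrix (Fin 8) (Fin 8) ℂ} (h : ρ.trace = 1) :
    IsSeparable ρ ↔ ρ ∈ convexHull ℝ pureProductStates := by
  constructor
  · rintro ⟨t, _, σ, hσ, rfl⟩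
    rw [Matrix.trace_smul, trace_of_mem_convexHull hσ] at h
    have ht : t = 1 := by simpa using h
    simpa [ht] using hσ
  · intro hρ
    exact ⟨1, zero_le_one, ρ, hρ, (one_smul ℝ ρ).symm⟩

end

end XState

namespace XState

open scoped ComplexOrder ComplexConjugate

/-! ### The cone of separable matrices -/

/-! For a product vector, the anti-diagonal is `r • k`, with `r` the product of the six coordinate
moduli and `k` of the form `(uv, uw, u w̄, u v̄)` with unimodular `u, v, w`. The norm `xNorm` is the
support function of the set `productPhases` of these `k`, so its dual ball is their convex hull
(`exists_smul_mem_convexHull_productPhases`, by Hahn–Banach).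

Necessity: product vectors attain every geometric-mean bound in `delta` at this `r`, and geometric
means are superadditive. Hence `IsXBounded` cuts out a convex cone containing the pure product
states.

Sufficiency: write `c = Δ • k` with `k` in the hull. With the diagonal fixed, separability is convex
in `k`, so a single phase vector suffices. The diagonal is then lowered to one that comes from a
product vector (`DiagBound.exists_le`); the excess is diagonal, hence separable. The lowered matrix
is the `X`-part of a product projection, which is separable by averaging over local sign flips. -/

theorem pureProductStates_nonempty : pureProductStates.Nonempty :=
  ⟨_, EuclideanSpace.single 0 1, EuclideanSpace.single 0 1, EuclideanSpace.single 0 1,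
    by simp, by simp, by simp, rfl⟩

theorem IsSeparable.zero : IsSeparable 0 := by
  obtain ⟨P, hP⟩ := pureProductStates_nonempty
  exact ⟨0, le_rfl, P, subset_convexHull ℝ _ hP, (zero_smul ℝ P).symm⟩

theorem IsSeparable.smul {ρ : Matrix (Fin 8) (Fin 8) ℂ} (h : IsSeparable ρ) {t : ℝ}
    (ht : 0 ≤ t) : IsSeparable (t • ρ) := by
  obtain ⟨s, hs, σ, hσ, rfl⟩ := h
  exact ⟨t * s, mul_nonneg ht hs, σ, hσ, smul_smul t s σ⟩

theorem IsSeparable.add {ρ ρ' : Matrix (Fin 8) (Fin 8) ℂ} (h : IsSeparable ρ)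
    (h' : IsSeparable ρ') : IsSeparable (ρ + ρ') := by
  obtain ⟨s, hs, σ, hσ, rfl⟩ := h
  obtain ⟨t, ht, τ, hτ, rfl⟩ := h'
  rcases (add_nonneg hs ht).eq_or_lt with h0 | h0
  · have hs0 : s = 0 := by linarith
    have ht0 : t = 0 := by linarith
    subst hs0 ht0
    simpa using IsSeparable.zero
  · refine ⟨s + t, h0.le, (s / (s + t)) • σ + (t / (s + t)) • τ,
      convex_convexHull ℝ _ hσ hτ (by positivity) (by positivity) (by field_simp), ?_⟩
    rw [smul_add, smul_smul, smul_smul, mul_div_cancel₀ _ h0.ne', mul_div_cancel₀ _ h0.ne']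

theorem prodVec_smul (r s t : ℝ) (x y z : EuclideanSpace ℂ (Fin 2)) :
    prodVec (r • x) (s • y) (t • z) = (r * s * t) • prodVec x y z := by
  ext i
  fin_cases i <;> simp [prodVec] <;> ring

theorem isSeparable_vecMulVec_prodVec (x y z : EuclideanSpace ℂ (Fin 2)) :
    IsSeparable (Matrix.vecMulVec (prodVec x y z) (star (prodVec x y z))) := by
  have key : ∀ v : EuclideanSpace ℂ (Fin 2), ∃ w : EuclideanSpace ℂ (Fin 2), ‖w‖ = 1 ∧
      v = ‖v‖ • w := by
    intro v
    rcases eq_or_ne v 0 with rfl | hv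
    · exact ⟨EuclideanSpace.single 0 1, by simp, by simp⟩
    · refine ⟨(‖v‖⁻¹ : ℝ) • v, ?_, ?_⟩
      · rw [norm_smul, norm_inv, norm_norm, inv_mul_cancel₀ (norm_ne_zero_iff.2 hv)]
      · rw [smul_smul, mul_inv_cancel₀ (norm_ne_zero_iff.2 hv), one_smul]
  obtain ⟨x', hx, ex⟩ := key x
  obtain ⟨y', hy, ey⟩ := key y
  obtain ⟨z', hz, ez⟩ := key z
  rw [ex, ey, ez, prodVec_smul]
  refine ⟨(‖x‖ * ‖y‖ * ‖z‖) ^ 2, sq_nonneg _, _,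
    subset_convexHull ℝ _ ⟨x', y', z', hx, hy, hz, rfl⟩, ?_⟩
  rw [star_smul, Matrix.smul_vecMulVec, Matrix.vecMulVec_smul, smul_smul, star_trivial, sq]

/-! ### Algebra of `X`-shaped matrices -/

theorem xMatrix_add (a a' b b' : Fin 4 → ℝ) (c c' : Fin 4 → ℂ) :
    xMatrix a b c + xMatrix a' b' c' = xMatrix (a + a') (b + b') (c + c') := by
  ext i j
  fin_cases i <;> fin_cases j <;> simp [xMatrix]

theorem xMatrix_smul (t : ℝ) (a b : Fin 4 → ℝ) (c : Fin 4 → ℂ) :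
    t • xMatrix a b c = xMatrix (t • a) (t • b) (t • c) := by
  ext i j
  fin_cases i <;> fin_cases j <;> simp [xMatrix]

/-- The sign changes of `ℂ⁸` generated by flipping the sign of the second basis vector in two of the
three tensor factors; they average every matrix to its `X`-part. -/
theorem sum_vecMulVec_signs (v : Fin 8 → ℂ) :
    (Matrix.vecMulVec v (star v) +
      Matrix.vecMulVec (![1, 1, -1, -1, -1, -1, 1, 1] * v)
        (star (![1, 1, -1, -1, -1, -1, 1, 1] * v))) +
      (Matrix.vecMulVec (![1, -1, 1, -1, -1, 1, -1, 1] * v)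
        (star (![1, -1, 1, -1, -1, 1, -1, 1] * v)) +
      Matrix.vecMulVec (![1, -1, -1, 1, 1, -1, -1, 1] * v)
        (star (![1, -1, -1, 1, 1, -1, -1, 1] * v))) =
    (4 : ℝ) • xMatrix ![‖v 0‖ ^ 2, ‖v 1‖ ^ 2, ‖v 2‖ ^ 2, ‖v 3‖ ^ 2]
      ![‖v 7‖ ^ 2, ‖v 6‖ ^ 2, ‖v 5‖ ^ 2, ‖v 4‖ ^ 2]
      ![v 0 * conj (v 7), v 1 * conj (v 6), v 2 * conj (v 5), v 3 * conj (v 4)] := by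
  ext i j
  simp only [Matrix.add_apply, Matrix.smul_apply, Matrix.vecMulVec_apply, Pi.star_apply,
    Pi.mul_apply, Complex.star_def, map_mul, Complex.real_smul]
  fin_cases i <;> fin_cases j <;>
    simp [xMatrix, ← Complex.mul_conj'] <;> ring

/-- Flipping signs in two tensor factors keeps a vector a product, so the `X`-part of a product
projection is an average of four product projections. -/
theorem isSeparable_xMatrix_of_product (x₀ x₁ y₀ y₁ z₀ z₁ : ℂ) :
    IsSeparable (xMatrix
      ![‖x₀ * y₀ * z₀‖ ^ 2, ‖x₀ * y₀ * z₁‖ ^ 2, ‖x₀ * y₁ * z₀‖ ^ 2, ‖x₀ * y₁ * z₁‖ ^ 2]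
      ![‖x₁ * y₁ * z₁‖ ^ 2, ‖x₁ * y₁ * z₀‖ ^ 2, ‖x₁ * y₀ * z₁‖ ^ 2, ‖x₁ * y₀ * z₀‖ ^ 2]
      ![x₀ * y₀ * z₀ * conj (x₁ * y₁ * z₁), x₀ * y₀ * z₁ * conj (x₁ * y₁ * z₀),
        x₀ * y₁ * z₀ * conj (x₁ * y₀ * z₁), x₀ * y₁ * z₁ * conj (x₁ * y₀ * z₀)]) := by
  have e₁ : prodVec !₂[x₀, -x₁] !₂[y₀, -y₁] !₂[z₀, z₁] =
      ![1, 1, -1, -1, -1, -1, 1, 1] * prodVec !₂[x₀, x₁] !₂[y₀, y₁] !₂[z₀, z₁] := by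
    ext i
    fin_cases i <;> simp [prodVec]
  have e₂ : prodVec !₂[x₀, -x₁] !₂[y₀, y₁] !₂[z₀, -z₁] =
      ![1, -1, 1, -1, -1, 1, -1, 1] * prodVec !₂[x₀, x₁] !₂[y₀, y₁] !₂[z₀, z₁] := by
    ext i
    fin_cases i <;> simp [prodVec]
  have e₃ : prodVec !₂[x₀, x₁] !₂[y₀, -y₁] !₂[z₀, -z₁] =
      ![1, -1, -1, 1, 1, -1, -1, 1] * prodVec !₂[x₀, x₁] !₂[y₀, y₁] !₂[z₀, z₁] := by
    ext i
    fin_cases i <;> simp [prodVec]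
  have h := (((isSeparable_vecMulVec_prodVec !₂[x₀, x₁] !₂[y₀, y₁] !₂[z₀, z₁]).add
    (isSeparable_vecMulVec_prodVec !₂[x₀, -x₁] !₂[y₀, -y₁] !₂[z₀, z₁])).add
    ((isSeparable_vecMulVec_prodVec !₂[x₀, -x₁] !₂[y₀, y₁] !₂[z₀, -z₁]).add
    (isSeparable_vecMulVec_prodVec !₂[x₀, x₁] !₂[y₀, -y₁] !₂[z₀, -z₁]))).smul
    (t := (4 : ℝ)⁻¹) (by positivity)
  rw [e₁, e₂, e₃, sum_vecMulVec_signs, smul_smul, inv_mul_cancel₀ (by norm_num), one_smul] at h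
  exact h

theorem isSeparable_xMatrix_zero {a b : Fin 4 → ℝ} (ha : ∀ i, 0 ≤ a i) (hb : ∀ i, 0 ≤ b i) :
    IsSeparable (xMatrix a b 0) := by
  have hA := fun x₀ x₁ y₀ y₁ z₀ z₁ t (ht : 0 ≤ t) =>
    (isSeparable_xMatrix_of_product x₀ x₁ y₀ y₁ z₀ z₁).smul (t := t) ht
  have h := ((((hA 1 0 1 0 1 0 _ (ha 0)).add (hA 1 0 1 0 0 1 _ (ha 1))).add
    ((hA 1 0 0 1 1 0 _ (ha 2)).add (hA 1 0 0 1 0 1 _ (ha 3)))).add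
    (((hA 0 1 0 1 0 1 _ (hb 0)).add (hA 0 1 0 1 1 0 _ (hb 1))).add
    ((hA 0 1 1 0 0 1 _ (hb 2)).add (hA 0 1 1 0 1 0 _ (hb 3)))))
  simp only [xMatrix_smul, xMatrix_add] at h
  convert h using 2
  · ext i; fin_cases i <;> simp
  · ext i; fin_cases i <;> simp
  · ext i; fin_cases i <;> simp

/-! ### Convex hulls of compact sets -/

/-- In a finite-dimensional space the convex hull of a compact set is compact. -/
theorem isCompact_convexHull_of_finiteDimensional {E : Type*} [NormedAddCommGroup E]
    [NormedSpace ℝ E] [FiniteDimensional ℝ E] {s : Set E} (hs : IsCompact s) :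
    IsCompact (convexHull ℝ s) := by
  rcases s.eq_empty_or_nonempty with rfl | ⟨x₀, hx₀⟩
  · simp
  -- By Carathéodory, `finrank + 1` points suffice, so the hull is a continuous image of simplex ×
  -- `s ^ (finrank + 1)`.
  have hK := ((isCompact_stdSimplex ℝ (Fin (Module.finrank ℝ E + 1))).prod
    (isCompact_univ_pi fun _ : Fin (Module.finrank ℝ E + 1) => hs)).image
    (f := fun p : (Fin (Module.finrank ℝ E + 1) → ℝ) × (Fin (Module.finrank ℝ E + 1) → E) =>
      ∑ i, p.1 i • p.2 i) (by fun_prop)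
  convert hK using 1
  refine Set.Subset.antisymm (fun x hx => ?_) ?_
  · obtain ⟨ι, _, z, w, hz, hi, hw, hw1, rfl⟩ := eq_pos_convex_span_of_mem_convexHull hx
    obtain ⟨e⟩ := Function.Embedding.nonempty_of_card_le (α := ι)
      (β := Fin (Module.finrank ℝ E + 1))
      (by
        rw [Fintype.card_fin]
        exact hi.card_le_finrank_succ.trans (Nat.add_le_add_right (Submodule.finrank_le _) 1))
    have hw0 : ∀ j ∉ Set.range e, Function.extend e w 0 j = 0 := fun j hj =>
      Function.extend_apply' _ _ j fun ⟨i, hi⟩ => hj ⟨i, hi⟩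
    -- Unused slots get weight `0` and the dummy point `x₀`.
    refine ⟨(Function.extend e w 0, Function.extend e z fun _ => x₀),
      ⟨⟨fun j => ?_, ?_⟩, fun j _ => ?_⟩, ?_⟩
    · by_cases hj : j ∈ Set.range e
      · obtain ⟨i, rfl⟩ := hj
        simp only [e.injective.extend_apply]
        exact (hw i).le
      · exact (hw0 j hj).ge
    · rw [← hw1]
      exact (Fintype.sum_of_injective e e.injective _ _ hw0
        fun i => (e.injective.extend_apply w 0 i).symm).symm
    · by_cases hj : j ∈ Set.range e
      · obtain ⟨i, rfl⟩ := hj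
        simp only [e.injective.extend_apply]
        exact hz ⟨i, rfl⟩
      · simp only [Function.extend_apply' z _ j fun ⟨i, hi⟩ => hj ⟨i, hi⟩]
        exact hx₀
    · refine (Fintype.sum_of_injective e e.injective _ _ (fun j hj => ?_) fun i => ?_).symm
      · simp only [hw0 j hj, zero_smul]
      · simp only [e.injective.extend_apply]
  · rintro _ ⟨⟨w, z⟩, ⟨⟨hw, hw1⟩, hz⟩, rfl⟩
    exact (convex_convexHull ℝ s).sum_mem (fun i _ => hw i) hw1
      fun i _ => subset_convexHull ℝ s (hz i (Set.mem_univ i))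

/-! ### The norm `xNorm` as a support function -/

/-- Factoring out the conjugate phase of `u` leaves the expression under the supremum at `σ = 2 arg
u`. -/
theorem norm_add_norm_le_xNorm (z : Fin 4 → ℂ) (u : ℂ) :
    ‖u * z 0 + conj u * conj (z 3)‖ + ‖u * z 1 + conj u * conj (z 2)‖ ≤ ‖u‖ * xNorm z := by
  have key : ∀ v w : ℂ, ‖u * v + conj u * conj w‖ =
      ‖u‖ * ‖v * Complex.exp ((2 * u.arg : ℝ) * Complex.I) + star w‖ := by
    intro v w
    have hu := Complex.norm_mul_exp_arg_mul_I u
    set e := Complex.exp (u.arg * Complex.I) with he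
    have hee : ‖e‖ = 1 := Complex.norm_exp_ofReal_mul_I _
    have hec : e * conj e = 1 := by rw [Complex.mul_conj', hee]; norm_num
    have h2 : Complex.exp ((2 * u.arg : ℝ) * Complex.I) = e * e := by
      rw [he, ← Complex.exp_add]; congr 1; push_cast; ring
    have h3 : u * v + conj u * conj w =
        conj e * ((‖u‖ : ℂ) * (v * Complex.exp ((2 * u.arg : ℝ) * Complex.I) + star w)) := by
      rw [h2]
      conv_lhs => rw [← hu]
      simp only [map_mul, Complex.conj_ofReal, Complex.star_def]
      linear_combination (-(‖u‖ : ℂ) * v * e) * hec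
    rw [h3, norm_mul, norm_mul, Complex.norm_real, norm_norm, Complex.norm_conj, hee, one_mul]
  rw [key, key, ← mul_add]
  exact mul_le_mul_of_nonneg_left (le_ciSup (xNorm_bddAbove z) (2 * u.arg)) (norm_nonneg u)

/-- Conjugating the last two terms does not change their real parts and lets `v` and `w` be factored
out. -/
theorem re_sum_mul_le_xNorm (z : Fin 4 → ℂ) (u v w : ℂ) (h : ‖w‖ = ‖v‖) :
    (∑ i, ![u * v, u * w, u * conj w, u * conj v] i * z i).re ≤ ‖u‖ * ‖v‖ * xNorm z := by
  have h1 := (Complex.re_le_norm (v * (u * z 0 + conj u * conj (z 3))))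
  have h2 := (Complex.re_le_norm (w * (u * z 1 + conj u * conj (z 2))))
  rw [norm_mul] at h1 h2
  rw [h] at h2
  have h3 := mul_le_mul_of_nonneg_left (norm_add_norm_le_xNorm z u) (norm_nonneg v)
  have e : (∑ i, ![u * v, u * w, u * conj w, u * conj v] i * z i).re =
      (v * (u * z 0 + conj u * conj (z 3))).re + (w * (u * z 1 + conj u * conj (z 2))).re := by
    simp [Fin.sum_univ_four]
    ring
  rw [e]
  linarith

theorem exists_norm_one_mul_eq_norm (v : ℂ) : ∃ w : ℂ, ‖w‖ = 1 ∧ w * v = ‖v‖ := by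
  refine ⟨conj (Complex.exp (v.arg * Complex.I)), ?_, ?_⟩
  · rw [Complex.norm_conj, Complex.norm_exp_ofReal_mul_I]
  · have hec : Complex.exp (v.arg * Complex.I) * conj (Complex.exp (v.arg * Complex.I)) = 1 := by
      rw [Complex.mul_conj', Complex.norm_exp_ofReal_mul_I]; norm_num
    have hv := Complex.norm_mul_exp_arg_mul_I v
    linear_combination (‖v‖ : ℂ) * hec - conj (Complex.exp (v.arg * Complex.I)) * hv

/-- The vectors of anti-diagonal phases of the pure product states. -/
def productPhases : Set (Fin 4 → ℂ) :=
  {k | ∃ u v w : ℂ, ‖u‖ = 1 ∧ ‖v‖ = 1 ∧ ‖w‖ = 1 ∧ k = ![u * v, u * w, u * conj w, u * conj v]}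

/-- The other half of the support-function property: for each `σ`, take `u = exp(iσ/2)` and let `v,
w` rotate the two summands onto the positive axis. -/
theorem mul_xNorm_le_of_forall_productPhases {z : Fin 4 → ℂ} {r t : ℝ} (hr : 0 ≤ r)
    (h : ∀ k ∈ productPhases, r * (∑ i, k i * z i).re ≤ t) : r * xNorm z ≤ t := by
  rw [xNorm, Real.mul_iSup_of_nonneg hr]
  refine ciSup_le fun σ => ?_
  set u := Complex.exp ((σ / 2 : ℝ) * Complex.I) with hu
  have hu1 : ‖u‖ = 1 := Complex.norm_exp_ofReal_mul_I _
  have huu : Complex.exp (σ * Complex.I) = u * u := by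
    rw [hu, ← Complex.exp_add]; congr 1; push_cast; ring
  have huc : u * conj u = 1 := by rw [Complex.mul_conj', hu1]; norm_num
  have key : ∀ v w : ℂ, ‖v * Complex.exp (σ * Complex.I) + star w‖ =
      ‖u * v + conj u * conj w‖ := by
    intro v w
    have : v * Complex.exp (σ * Complex.I) + star w = u * (u * v + conj u * conj w) := by
      rw [huu, Complex.star_def]; linear_combination (-conj w) * huc
    rw [this, norm_mul, hu1, one_mul]
  rw [key, key]
  obtain ⟨v, hv, ev⟩ := exists_norm_one_mul_eq_norm (u * z 0 + conj u * conj (z 3))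
  obtain ⟨w, hw, ew⟩ := exists_norm_one_mul_eq_norm (u * z 1 + conj u * conj (z 2))
  refine le_of_eq_of_le ?_ (h _ ⟨u, v, w, hu1, hv, hw, rfl⟩)
  have ev' := congrArg Complex.re ev
  have ew' := congrArg Complex.re ew
  rw [Complex.ofReal_re] at ev' ew'
  rw [← ev', ← ew']
  congr 1
  simp [Fin.sum_univ_four]
  ring

theorem isCompact_productPhases : IsCompact productPhases := by
  have hK := ((isCompact_sphere (0 : ℂ) 1).prod
    ((isCompact_sphere (0 : ℂ) 1).prod (isCompact_sphere (0 : ℂ) 1))).image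
    (f := fun p : ℂ × ℂ × ℂ =>
      (![p.1 * p.2.1, p.1 * p.2.2, p.1 * conj p.2.2, p.1 * conj p.2.1] : Fin 4 → ℂ))
    (by
      refine continuous_pi fun i => ?_
      fin_cases i <;> simp <;> fun_prop)
  convert hK using 1
  ext k
  simp only [productPhases, Set.mem_ofPred_eq, Set.mem_image, Set.mem_prod, mem_sphere_zero_iff_norm,
    Prod.exists]
  constructor
  · rintro ⟨u, v, w, hu, hv, hw, rfl⟩
    exact ⟨u, v, w, ⟨hu, hv, hw⟩, rfl⟩
  · rintro ⟨u, v, w, ⟨hu, hv, hw⟩, rfl⟩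
    exact ⟨u, v, w, hu, hv, hw, rfl⟩

theorem xNorm_smul {t : ℝ} (ht : 0 ≤ t) (z : Fin 4 → ℂ) : xNorm (t • z) = t * xNorm z := by
  rw [xNorm, xNorm, Real.mul_iSup_of_nonneg ht]
  congr 1
  ext σ
  have key : ∀ v w e : ℂ, ‖(t • v) * e + star (t • w)‖ = t * ‖v * e + star w‖ := by
    intro v w e
    have : (t • v) * e + star (t • w) = t • (v * e + star w) := by
      rw [star_smul, star_trivial, smul_add, smul_mul_assoc]
    rw [this, norm_smul, Real.norm_of_nonneg ht]
  simp only [Pi.smul_apply, key, mul_add]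

theorem re_sum_mul_le_xDualNorm_mul_xNorm (c z : Fin 4 → ℂ) :
    (∑ i, c i * z i).re ≤ xDualNorm c * xNorm z := by
  have h0 : 0 ≤ xNorm z := (norm_nonneg _).trans (norm_le_xNorm z 0)
  rcases h0.eq_or_lt with h | h
  · have hz : ∀ i, z i = 0 := fun i =>
      norm_le_zero_iff.1 ((norm_le_xNorm z i).trans h.symm.le)
    simp [hz, ← h]
  · have hle : (∑ i, c i * ((xNorm z)⁻¹ • z) i).re ≤ xDualNorm c :=
      le_csSup (xDualNorm_bddAbove c) ⟨(xNorm z)⁻¹ • z, by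
        rw [xNorm_smul (inv_nonneg.2 h0), inv_mul_cancel₀ h.ne'], rfl⟩
    have e : (∑ i, c i * ((xNorm z)⁻¹ • z) i).re = (xNorm z)⁻¹ * (∑ i, c i * z i).re := by
      simp only [Pi.smul_apply, mul_smul_comm, ← Finset.smul_sum, Complex.smul_re, smul_eq_mul]
    rw [e, inv_mul_le_iff₀ h] at hle
    linarith

theorem exists_eq_re_sum_mul (f : (Fin 4 → ℂ) →L[ℝ] ℝ) :
    ∃ z : Fin 4 → ℂ, ∀ c, f c = (∑ i, c i * z i).re := by
  -- The minus sign comes from `Re((x + iy)(p + iq)) = xp - yq`.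
  refine ⟨fun i => ⟨f (Pi.single i 1), -f (Pi.single i Complex.I)⟩, fun c => ?_⟩
  have hc : c = ∑ i, ((c i).re • (Pi.single i 1 : Fin 4 → ℂ) +
      (c i).im • (Pi.single i Complex.I : Fin 4 → ℂ)) := by
    conv_lhs => rw [← Finset.univ_sum_single c]
    refine Finset.sum_congr rfl fun i _ => ?_
    rw [← Pi.single_smul, ← Pi.single_smul, ← Pi.single_add]
    congr 1
    simp [Complex.re_add_im]
  conv_lhs => rw [hc]
  simp [Complex.mul_re]

/-- The dual ball of radius `r` is `r` times the convex hull of the product phases. -/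
theorem exists_smul_mem_convexHull_productPhases {c : Fin 4 → ℂ} {r : ℝ} (hr : 0 ≤ r)
    (h : xDualNorm c ≤ r) : ∃ k ∈ convexHull ℝ productPhases, c = r • k := by
  have hC : IsCompact ((fun k : Fin 4 → ℂ => r • k) '' convexHull ℝ productPhases) :=
    (isCompact_convexHull_of_finiteDimensional isCompact_productPhases).image (continuous_const_smul r)
  by_contra hcon
  have hc : c ∉ (fun k : Fin 4 → ℂ => r • k) '' convexHull ℝ productPhases := by
    rintro ⟨k, hk, rfl⟩
    exact hcon ⟨k, hk, rfl⟩
  -- Writing `f` as pairing with `z`, separation gives `r‖z‖ ≤ t < f c ≤ ‖c‖'‖z‖ ≤ r‖z‖`, a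
  -- contradiction.
  obtain ⟨f, t, hf, hfc⟩ := geometric_hahn_banach_closed_point
    ((convex_convexHull ℝ _).smul r) hC.isClosed hc
  obtain ⟨z, hz⟩ := exists_eq_re_sum_mul f
  have h1 : r * xNorm z ≤ t := mul_xNorm_le_of_forall_productPhases hr fun k hk => by
    have := hf _ ⟨k, subset_convexHull ℝ _ hk, rfl⟩
    rw [map_smul, smul_eq_mul, hz] at this
    exact this.le
  have h2 := re_sum_mul_le_xDualNorm_mul_xNorm c z
  rw [← hz] at h2
  have h3 := mul_le_mul_of_nonneg_right h ((norm_nonneg _).trans (norm_le_xNorm z 0))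
  linarith

/-! ### Necessity -/

/-- Superadditivity of the geometric mean: AM–GM bounds the cross term `2rr'` by `ab' + a'b`. -/
theorem sq_add_le_mul_of_sq_le_mul {a b a' b' r r' : ℝ} (ha : 0 ≤ a) (hb : 0 ≤ b) (ha' : 0 ≤ a')
    (hb' : 0 ≤ b') (h : r ^ 2 ≤ a * b) (h' : r' ^ 2 ≤ a' * b') :
    (r + r') ^ 2 ≤ (a + a') * (b + b') := by
  have h1 : (r * r') ^ 2 ≤ (a * b') * (a' * b) := by
    calc (r * r') ^ 2 = r ^ 2 * r' ^ 2 := by ring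
      _ ≤ (a * b) * (a' * b') := mul_le_mul h h' (sq_nonneg _) (mul_nonneg ha hb)
      _ = _ := by ring
  have h2 : 2 * (r * r') ≤ a * b' + a' * b := by
    refine le_of_sq_le_sq ?_ (by positivity)
    nlinarith [sq_nonneg (a * b' - a' * b)]
  nlinarith

/-- A fourth root is a geometric mean of two geometric means, so the two-variable case is applied
twice. -/
theorem pow_four_add_le_mul_of_pow_four_le_mul {a b c d a' b' c' d' r r' : ℝ} (ha : 0 ≤ a)
    (hb : 0 ≤ b) (hc : 0 ≤ c) (hd : 0 ≤ d) (ha' : 0 ≤ a') (hb' : 0 ≤ b') (hc' : 0 ≤ c')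
    (hd' : 0 ≤ d') (h : r ^ 4 ≤ a * b * c * d)
    (h' : r' ^ 4 ≤ a' * b' * c' * d') :
    (r + r') ^ 4 ≤ (a + a') * (b + b') * (c + c') * (d + d') := by
  have key : ∀ {a b c d r : ℝ}, 0 ≤ a → 0 ≤ b → 0 ≤ c → 0 ≤ d → r ^ 4 ≤ a * b * c * d →
      r ^ 2 ≤ √(a * b) * √(c * d) := by
    intro a b c d r ha hb hc hd h
    rw [← Real.sqrt_mul (by positivity)]
    exact Real.le_sqrt_of_sq_le (by nlinarith)
  have h1 := sq_add_le_mul_of_sq_le_mul (Real.sqrt_nonneg _) (Real.sqrt_nonneg _)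
    (Real.sqrt_nonneg _) (Real.sqrt_nonneg _) (key ha hb hc hd h)
    (key ha' hb' hc' hd' h')
  have h2 := sq_add_le_mul_of_sq_le_mul ha hb ha' hb'
    (Real.sq_sqrt (by positivity)).le (Real.sq_sqrt (by positivity)).le
  have h3 := sq_add_le_mul_of_sq_le_mul hc hd hc' hd'
    (Real.sq_sqrt (by positivity)).le (Real.sq_sqrt (by positivity)).le
  calc (r + r') ^ 4 = ((r + r') ^ 2) ^ 2 := by ring
    _ ≤ ((√(a * b) + √(a' * b')) * (√(c * d) + √(c' * d'))) ^ 2 :=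
      pow_le_pow_left₀ (sq_nonneg _) h1 2
    _ = (√(a * b) + √(a' * b')) ^ 2 * (√(c * d) + √(c' * d')) ^ 2 := by ring
    _ ≤ ((a + a') * (b + b')) * ((c + c') * (d + d')) :=
      mul_le_mul h2 h3 (sq_nonneg _) (by positivity)
    _ = _ := by ring

/-- `r` is dominated by the geometric means occurring in `delta`. -/
structure DiagBound (a b : Fin 4 → ℝ) (r : ℝ) : Prop where
  left_nonneg : ∀ i, 0 ≤ a i
  right_nonneg : ∀ i, 0 ≤ b i
  nonneg : 0 ≤ r
  sq_le : ∀ i, r ^ 2 ≤ a i * b i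
  pow_four_le : r ^ 4 ≤ a 0 * b 1 * b 2 * a 3
  pow_four_le' : r ^ 4 ≤ b 0 * a 1 * a 2 * b 3

theorem DiagBound.add {a b a' b' : Fin 4 → ℝ} {r r' : ℝ} (h : DiagBound a b r)
    (h' : DiagBound a' b' r') : DiagBound (a + a') (b + b') (r + r') where
  left_nonneg i := add_nonneg (h.1 i) (h'.1 i)
  right_nonneg i := add_nonneg (h.2 i) (h'.2 i)
  nonneg := add_nonneg h.3 h'.3
  sq_le i := sq_add_le_mul_of_sq_le_mul (h.1 i) (h.2 i) (h'.1 i) (h'.2 i)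
    (h.4 i) (h'.4 i)
  pow_four_le := pow_four_add_le_mul_of_pow_four_le_mul (h.1 _) (h.2 _) (h.2 _) (h.1 _) (h'.1 _)
    (h'.2 _) (h'.2 _) (h'.1 _) h.5 h'.5
  pow_four_le' := pow_four_add_le_mul_of_pow_four_le_mul (h.2 _) (h.1 _) (h.1 _) (h.2 _) (h'.2 _)
    (h'.1 _) (h'.1 _) (h'.2 _) h.6 h'.6

theorem DiagBound.smul {a b : Fin 4 → ℝ} {r t : ℝ} (h : DiagBound a b r) (ht : 0 ≤ t) :
    DiagBound (t • a) (t • b) (t * r) where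
  left_nonneg i := mul_nonneg ht (h.1 i)
  right_nonneg i := mul_nonneg ht (h.2 i)
  nonneg := mul_nonneg ht h.3
  sq_le i := by
    have := mul_le_mul_of_nonneg_left (h.4 i) (pow_nonneg ht 2)
    simp only [Pi.smul_apply, smul_eq_mul]
    nlinarith
  pow_four_le := by
    have := mul_le_mul_of_nonneg_left h.5 (pow_nonneg ht 4)
    simp only [Pi.smul_apply, smul_eq_mul]
    nlinarith
  pow_four_le' := by
    have := mul_le_mul_of_nonneg_left h.6 (pow_nonneg ht 4)
    simp only [Pi.smul_apply, smul_eq_mul]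
    nlinarith

theorem le_delta_iff {a b : Fin 4 → ℝ} (ha : ∀ i, 0 ≤ a i) (hb : ∀ i, 0 ≤ b i) {r : ℝ}
    (hr : 0 ≤ r) : r ≤ delta a b ↔ DiagBound a b r := by
  have key : ∀ {x : ℝ}, 0 ≤ x → (r ≤ x ^ (1 / 4 : ℝ) ↔ r ^ 4 ≤ x) := by
    intro x hx
    rw [one_div, Real.le_rpow_inv_iff_of_pos hr hx (by norm_num)]
    norm_cast
  have h0 : ∀ i, (r ≤ √(a i * b i) ↔ r ^ 2 ≤ a i * b i) := fun i =>
    Real.le_sqrt hr (mul_nonneg (ha i) (hb i))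
  have p1 : 0 ≤ a 0 * b 1 * b 2 * a 3 :=
    mul_nonneg (mul_nonneg (mul_nonneg (ha _) (hb _)) (hb _)) (ha _)
  have p2 : 0 ≤ b 0 * a 1 * a 2 * b 3 :=
    mul_nonneg (mul_nonneg (mul_nonneg (hb _) (ha _)) (ha _)) (hb _)
  simp only [delta, le_min_iff, h0, key p1, key p2]
  constructor
  · rintro ⟨⟨⟨h1, h2⟩, h3, h4⟩, h5, h6⟩
    refine ⟨ha, hb, hr, fun i => ?_, h5, h6⟩
    fin_cases i <;> assumption
  · intro h
    exact ⟨⟨⟨h.4 0, h.4 1⟩, h.4 2, h.4 3⟩, h.5, h.6⟩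

/-- The real parts of the upper half of the diagonal. -/
def upperDiag (M : Matrix (Fin 8) (Fin 8) ℂ) : Fin 4 → ℝ :=
  ![(M 0 0).re, (M 1 1).re, (M 2 2).re, (M 3 3).re]

/-- The real parts of the lower half of the diagonal, read from the bottom. -/
def lowerDiag (M : Matrix (Fin 8) (Fin 8) ℂ) : Fin 4 → ℝ :=
  ![(M 7 7).re, (M 6 6).re, (M 5 5).re, (M 4 4).re]

/-- The upper half of the anti-diagonal. -/
def antiDiag (M : Matrix (Fin 8) (Fin 8) ℂ) : Fin 4 → ℂ :=
  ![M 0 7, M 1 6, M 2 5, M 3 4]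

/-- The condition on diagonal and anti-diagonal that characterizes separable `X`-states; it makes
sense for all matrices, and these form a convex cone. -/
def IsXBounded (M : Matrix (Fin 8) (Fin 8) ℂ) : Prop :=
  ∃ r, DiagBound (upperDiag M) (lowerDiag M) r ∧
    ∀ z : Fin 4 → ℂ, (∑ i, antiDiag M i * z i).re ≤ r * xNorm z

theorem IsXBounded.add {M N : Matrix (Fin 8) (Fin 8) ℂ} (hM : IsXBounded M) (hN : IsXBounded N) :
    IsXBounded (M + N) := by
  obtain ⟨r, hr, h⟩ := hM
  obtain ⟨s, hs, h'⟩ := hN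
  refine ⟨r + s, ?_, fun z => ?_⟩
  · convert hr.add hs using 1 <;> ext i <;> fin_cases i <;> simp [upperDiag, lowerDiag]
  · have e : (∑ i, antiDiag (M + N) i * z i) =
        (∑ i, antiDiag M i * z i) + ∑ i, antiDiag N i * z i := by
      simp only [antiDiag, Fin.sum_univ_four, Matrix.add_apply, Matrix.cons_val]
      ring
    rw [e, Complex.add_re, add_mul]
    exact add_le_add (h z) (h' z)

theorem IsXBounded.smul {M : Matrix (Fin 8) (Fin 8) ℂ} (hM : IsXBounded M) {t : ℝ} (ht : 0 ≤ t) :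
    IsXBounded (t • M) := by
  obtain ⟨r, hr, h⟩ := hM
  refine ⟨t * r, ?_, fun z => ?_⟩
  · convert hr.smul ht using 1 <;> ext i <;> fin_cases i <;> simp [upperDiag, lowerDiag]
  · have e : (∑ i, antiDiag (t • M) i * z i) = t • ∑ i, antiDiag M i * z i := by
      simp only [antiDiag, Fin.sum_univ_four, Matrix.smul_apply, Matrix.cons_val, smul_add,
        smul_mul_assoc]
    rw [e, Complex.smul_re, smul_eq_mul, mul_assoc]
    exact mul_le_mul_of_nonneg_left (h z) ht

/-- All diagonal bounds are equalities here, with `r` the product of the six coordinate moduli. -/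
theorem isXBounded_vecMulVec_prodVec (x y z : EuclideanSpace ℂ (Fin 2)) :
    IsXBounded (Matrix.vecMulVec (prodVec x y z) (star (prodVec x y z))) := by
  have eu : upperDiag (Matrix.vecMulVec (prodVec x y z) (star (prodVec x y z))) =
      ![‖x 0‖ ^ 2 * ‖y 0‖ ^ 2 * ‖z 0‖ ^ 2, ‖x 0‖ ^ 2 * ‖y 0‖ ^ 2 * ‖z 1‖ ^ 2,
        ‖x 0‖ ^ 2 * ‖y 1‖ ^ 2 * ‖z 0‖ ^ 2, ‖x 0‖ ^ 2 * ‖y 1‖ ^ 2 * ‖z 1‖ ^ 2] := by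
    ext i
    fin_cases i <;> simp only [upperDiag, Matrix.vecMulVec_apply, Pi.star_apply, Complex.star_def,
      Complex.mul_conj', prodVec] <;> norm_cast <;> simp [mul_pow]
  have el : lowerDiag (Matrix.vecMulVec (prodVec x y z) (star (prodVec x y z))) =
      ![‖x 1‖ ^ 2 * ‖y 1‖ ^ 2 * ‖z 1‖ ^ 2, ‖x 1‖ ^ 2 * ‖y 1‖ ^ 2 * ‖z 0‖ ^ 2,
        ‖x 1‖ ^ 2 * ‖y 0‖ ^ 2 * ‖z 1‖ ^ 2, ‖x 1‖ ^ 2 * ‖y 0‖ ^ 2 * ‖z 0‖ ^ 2] := by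
    ext i
    fin_cases i <;> simp only [lowerDiag, Matrix.vecMulVec_apply, Pi.star_apply, Complex.star_def,
      Complex.mul_conj', prodVec] <;> norm_cast <;> simp [mul_pow]
  refine ⟨‖x 0‖ * ‖x 1‖ * (‖y 0‖ * ‖y 1‖ * (‖z 0‖ * ‖z 1‖)), ?_, fun w => ?_⟩
  · rw [eu, el]
    refine ⟨fun i => ?_, fun i => ?_, by positivity, fun i => ?_, le_of_eq ?_, le_of_eq ?_⟩
    · fin_cases i <;> simp <;> positivity
    · fin_cases i <;> simp <;> positivity
    · fin_cases i <;> simp <;> apply le_of_eq <;> ring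
    · simp
      ring
    · simp
      ring
  · have h := re_sum_mul_le_xNorm w (x 0 * conj (x 1)) (y 0 * conj (y 1) * (z 0 * conj (z 1)))
      (y 0 * conj (y 1) * conj (z 0 * conj (z 1))) (by simp)
    simp only [norm_mul, Complex.norm_conj] at h
    refine le_of_eq_of_le (congrArg Complex.re (Finset.sum_congr rfl fun i _ => ?_)) h
    congr 1
    fin_cases i <;> simp [antiDiag, prodVec, Matrix.vecMulVec_apply] <;> ring

theorem IsSeparable.isXBounded {ρ : Matrix (Fin 8) (Fin 8) ℂ} (h : IsSeparable ρ) :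
    IsXBounded ρ := by
  obtain ⟨t, ht, σ, hσ, rfl⟩ := h
  refine IsXBounded.smul ?_ ht
  have hc : Convex ℝ {M | IsXBounded M} := fun M hM N hN s t hs ht _ =>
    IsXBounded.add (IsXBounded.smul hM hs) (IsXBounded.smul hN ht)
  refine convexHull_min ?_ hc hσ
  rintro _ ⟨x, y, z, -, -, -, rfl⟩
  exact isXBounded_vecMulVec_prodVec x y z

theorem xDualNorm_le_of_isXBounded {a b : Fin 4 → ℝ} {c : Fin 4 → ℂ}
    (h : IsXBounded (xMatrix a b c)) : xDualNorm c ≤ delta a b := by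
  obtain ⟨r, hr, h⟩ := h
  have eu : upperDiag (xMatrix a b c) = a := by
    ext i; fin_cases i <;> simp [upperDiag, xMatrix]
  have el : lowerDiag (xMatrix a b c) = b := by
    ext i; fin_cases i <;> simp [lowerDiag, xMatrix]
  have ea : antiDiag (xMatrix a b c) = c := by
    ext i; fin_cases i <;> simp [antiDiag, xMatrix]
  rw [eu, el] at hr
  rw [ea] at h
  refine le_trans ?_ ((le_delta_iff hr.1 hr.2 hr.3).2 hr)
  refine csSup_le (xDualNorm_nonempty c) ?_
  rintro _ ⟨z, hz, rfl⟩
  simpa [hz] using h z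

/-! ### Sufficiency -/

/-- Along the edge `x = l` and then `y = u'` of the rectangle, the product runs from `l * l'`
through `l * u'` to `u * u'`. -/
theorem exists_mul_eq_of_mem_Icc {l u l' u' T : ℝ} (hl : 0 < l) (hu : l ≤ u) (hl' : 0 < l')
    (hu' : l' ≤ u') (h : l * l' ≤ T) (h' : T ≤ u * u') :
    ∃ x y, l ≤ x ∧ x ≤ u ∧ l' ≤ y ∧ y ≤ u' ∧ x * y = T := by
  rcases le_total T (l * u') with hT | hT
  · refine ⟨l, T / l, le_rfl, hu, (le_div_iff₀' hl).2 h, (div_le_iff₀' hl).2 hT, ?_⟩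
    field_simp
  · have hp : 0 < u' := hl'.trans_le hu'
    refine ⟨T / u', u', (le_div_iff₀ hp).2 hT, (div_le_iff₀ hp).2 h', hu', le_rfl, ?_⟩
    field_simp

/-- Each `d i` may range over `[r²/b i, a i]`. The fourth-power conditions, with the quadratic ones,
say exactly that the ranges of `d 0 * d 3` and `d 1 * d 2` meet. -/
theorem DiagBound.exists_le {a b : Fin 4 → ℝ} {r : ℝ} (h : DiagBound a b r) (hr : 0 < r) :
    ∃ d : Fin 4 → ℝ, (∀ i, 0 < d i) ∧ (∀ i, d i ≤ a i) ∧ (∀ i, r ^ 2 / d i ≤ b i) ∧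
      d 0 * d 3 = d 1 * d 2 := by
  have hr2 : 0 < r ^ 2 := pow_pos hr 2
  have hb : ∀ i, 0 < b i := fun i => (h.2 i).lt_of_ne fun h0 => by
    have := h.4 i
    rw [← h0, mul_zero] at this
    linarith
  have hl : ∀ i, 0 < r ^ 2 / b i := fun i => div_pos hr2 (hb i)
  have hu : ∀ i, r ^ 2 / b i ≤ a i := fun i => (div_le_iff₀ (hb i)).2 (h.4 i)
  have c1 : r ^ 2 / b 1 * (r ^ 2 / b 2) ≤ a 0 * a 3 := by
    rw [div_mul_div_comm, div_le_iff₀ (mul_pos (hb _) (hb _))]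
    linarith [h.5]
  have c2 : r ^ 2 / b 0 * (r ^ 2 / b 3) ≤ a 1 * a 2 := by
    rw [div_mul_div_comm, div_le_iff₀ (mul_pos (hb _) (hb _))]
    linarith [h.6]
  -- The common value of both products is the larger of the two lower endpoints.
  obtain ⟨x, y, hx, hx', hy, hy', e⟩ := exists_mul_eq_of_mem_Icc (hl 0) (hu 0) (hl 3) (hu 3)
    (le_max_left _ (r ^ 2 / b 1 * (r ^ 2 / b 2)))
    (max_le (mul_le_mul (hu 0) (hu 3) (hl 3).le (h.1 0)) c1)
  obtain ⟨x', y', hx1, hx1', hy1, hy1', e'⟩ := exists_mul_eq_of_mem_Icc (hl 1) (hu 1) (hl 2) (hu 2)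
    (le_max_right (r ^ 2 / b 0 * (r ^ 2 / b 3)) _)
    (max_le c2 (mul_le_mul (hu 1) (hu 2) (hl 2).le (h.1 1)))
  have key : ∀ {i : Fin 4} {x : ℝ}, r ^ 2 / b i ≤ x → 0 < x ∧ r ^ 2 / x ≤ b i := by
    intro i x hx
    have hx0 := (hl i).trans_le hx
    exact ⟨hx0, (div_le_comm₀ (hb i) hx0).1 hx⟩
  refine ⟨![x, x', y', y], fun i => ?_, fun i => ?_, fun i => ?_, e.trans e'.symm⟩
  · fin_cases i
    exacts [(key hx).1, (key hx1).1, (key hy1).1, (key hy).1]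
  · fin_cases i <;> assumption
  · fin_cases i
    exacts [(key hx).2, (key hx1).2, (key hy1).2, (key hy).2]

/-- Half the sum and half the difference of the arguments; this recovers phases for the second and
third factors from `v, w`. -/
theorem exists_mul_conj_eq {v w : ℂ} (hv : ‖v‖ = 1) (hw : ‖w‖ = 1) :
    ∃ s t : ℂ, ‖s‖ = 1 ∧ ‖t‖ = 1 ∧ s * t = v ∧ s * conj t = w := by
  have e : ∀ v : ℂ, ‖v‖ = 1 → v = Complex.exp (v.arg * Complex.I) := fun v hv => by
    conv_lhs => rw [← Complex.norm_mul_exp_arg_mul_I v, hv]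
    simp
  refine ⟨Complex.exp (((v.arg + w.arg) / 2 : ℝ) * Complex.I),
    Complex.exp (((v.arg - w.arg) / 2 : ℝ) * Complex.I), Complex.norm_exp_ofReal_mul_I _,
    Complex.norm_exp_ofReal_mul_I _, ?_, ?_⟩
  · conv_rhs => rw [e v hv]
    rw [← Complex.exp_add]
    congr 1
    push_cast
    ring
  · conv_rhs => rw [e w hw]
    rw [← Complex.exp_conj, ← Complex.exp_add]
    congr 1
    simp only [map_mul, Complex.conj_ofReal, Complex.conj_I]
    push_cast
    ring

theorem isSeparable_xMatrix_of_mul_eq_mul {d : Fin 4 → ℝ} {r : ℝ} (hd : ∀ i, 0 < d i)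
    (hr : 0 ≤ r) (h : d 0 * d 3 = d 1 * d 2) {k : Fin 4 → ℂ} (hk : k ∈ productPhases) :
    IsSeparable (xMatrix d (fun i => r ^ 2 / d i) (r • k)) := by
  obtain ⟨u, v, w, hu, hv, hw, rfl⟩ := hk
  obtain ⟨s, t, hs, ht, rfl, rfl⟩ := exists_mul_conj_eq hv hw
  have hd0 := hd 0
  have hd1 := hd 1
  have hd2 := hd 2
  have hd3 := hd 3
  set p := r / √(d 0 * d 3) with hp
  have hp0 : 0 ≤ p := by positivity
  have hp2 : p ^ 2 = r ^ 2 / (d 0 * d 3) := by rw [hp, div_pow, Real.sq_sqrt (by positivity)]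
  have h3 : d 3 = d 1 * d 2 / d 0 := by field_simp; linarith
  have h0' : √(d 0) ^ 2 = d 0 := Real.sq_sqrt hd0.le
  have h2' : √(d 2) ^ 2 = d 2 := Real.sq_sqrt hd2.le
  have h1' : √(d 1 / d 0) ^ 2 = d 1 / d 0 := Real.sq_sqrt (by positivity)
  have hprod : p * √(d 0) * √(d 2) * √(d 1 / d 0) = r := by
    refine (sq_eq_sq₀ (by positivity) hr).1 ?_
    rw [mul_pow, mul_pow, mul_pow, hp2, h0', h1', h2', h3]
    field_simp
  have hprod' : (p : ℂ) * √(d 0) * √(d 2) * √(d 1 / d 0) = r := by exact_mod_cast hprod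
  -- The moduli of the last two factors give `d 0, d 1, d 2`, and `d 3` follows from `h`. The scale
  -- `p` turns the lower diagonal into `r² / d i`.
  convert isSeparable_xMatrix_of_product 1 (p * conj u) (√(d 0)) (√(d 2) * conj s) 1
    (√(d 1 / d 0) * conj t) using 2
  · ext i
    fin_cases i <;> simp [mul_pow, hs, ht, h0', h1', h2', h3] <;> field_simp
  · ext i
    fin_cases i <;> simp [mul_pow, hs, ht, hu, h0', h1', h2', hp2, h3] <;> field_simp
  · rw [← hprod]
    ext i
    fin_cases i <;> simp <;> ring

theorem DiagBound.isSeparable_xMatrix {a b : Fin 4 → ℝ} {r : ℝ} (h : DiagBound a b r)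
    {k : Fin 4 → ℂ} (hk : k ∈ productPhases) : IsSeparable (xMatrix a b (r • k)) := by
  -- At `r = 0` the entries may vanish, so no positive `d` need exist, but the matrix is diagonal.
  rcases h.3.eq_or_lt with h0 | h0
  · rw [← h0, zero_smul]
    exact isSeparable_xMatrix_zero h.1 h.2
  · obtain ⟨d, hd, hda, hdb, e⟩ := h.exists_le h0
    have := (isSeparable_xMatrix_of_mul_eq_mul hd h.3 e hk).add
      (isSeparable_xMatrix_zero (a := a - d) (b := b - fun i => r ^ 2 / d i)
        (fun i => sub_nonneg.2 (hda i)) (fun i => sub_nonneg.2 (hdb i)))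
    rwa [xMatrix_add, add_sub_cancel, add_sub_cancel, add_zero] at this

theorem DiagBound.isSeparable_xMatrix_of_mem_convexHull {a b : Fin 4 → ℝ} {r : ℝ}
    (h : DiagBound a b r) {k : Fin 4 → ℂ} (hk : k ∈ convexHull ℝ productPhases) :
    IsSeparable (xMatrix a b (r • k)) := by
  have hc : Convex ℝ {k : Fin 4 → ℂ | IsSeparable (xMatrix a b (r • k))} := by
    intro k hk l hl s t hs ht hst
    have := (IsSeparable.smul hk hs).add (IsSeparable.smul hl ht)
    rw [xMatrix_smul, xMatrix_smul, xMatrix_add, ← add_smul, ← add_smul, hst, one_smul,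
      one_smul, smul_comm s r, smul_comm t r, ← smul_add] at this
    exact this
  exact convexHull_min (fun k hk => h.isSeparable_xMatrix hk) hc hk

theorem IsState.diag_nonneg {a b : Fin 4 → ℝ} {c : Fin 4 → ℂ} (h : IsState (xMatrix a b c)) :
    (∀ i, 0 ≤ a i) ∧ ∀ i, 0 ≤ b i := by
  have hd := fun i => (Complex.nonneg_iff.1 (Matrix.PosSemidef.diag_nonneg h (i := i))).1
  have h0 := hd 0
  have h1 := hd 1
  have h2 := hd 2
  have h3 := hd 3
  have h4 := hd 4
  have h5 := hd 5
  have h6 := hd 6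
  have h7 := hd 7
  simp [xMatrix] at h0 h1 h2 h3 h4 h5 h6 h7
  constructor <;> intro i <;> fin_cases i <;> assumption

theorem delta_nonneg (a b : Fin 4 → ℝ) (ha : ∀ i, 0 ≤ a i) (hb : ∀ i, 0 ≤ b i) :
    0 ≤ delta a b := by
  rw [le_delta_iff ha hb le_rfl]
  refine ⟨ha, hb, le_rfl, fun i => ?_, ?_, ?_⟩
  · simpa using mul_nonneg (ha i) (hb i)
  · simpa using mul_nonneg (mul_nonneg (mul_nonneg (ha 0) (hb 1)) (hb 2)) (ha 3)
  · simpa using mul_nonneg (mul_nonneg (mul_nonneg (hb 0) (ha 1)) (ha 2)) (hb 3)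

end XState

theorem theorem3p2 (a b : Fin 4 → ℝ) (c : Fin 4 → ℂ)
    (hρ : XState.IsState (XState.xMatrix a b c)) :
    XState.IsSeparable (XState.xMatrix a b c) ↔ XState.xDualNorm c ≤ XState.delta a b := by
  refine ⟨fun h => XState.xDualNorm_le_of_isXBounded h.isXBounded, fun h => ?_⟩
  obtain ⟨ha, hb⟩ := hρ.diag_nonneg
  have h0 := XState.delta_nonneg a b ha hb
  obtain ⟨k, hk, hc⟩ := XState.exists_smul_mem_convexHull_productPhases h0 h
  have hd := (XState.le_delta_iff ha hb h0).1 le_rfl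
  rw [hc]
  exact hd.isSeparable_xMatrix_of_mem_convexHull hk
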